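/- Let $n\in\mathbb N$, $h>0$, $T>0$, let $C=C([-h,T],\mathbb R^n)$ carry the uniform norm and $[0,T]\times C$ the product metric. A functional $\varphi:[0,T]\times C\to\mathbb R$ is called non-anticipative if, for all $t\in[0,T)$ and $x,y\in C$, $x=y$ on $[-h,t]$ implies $\varphi(t,x)=\varphi(t,y)$. Let $\mathrm{Lip}(t,x)$ be the set of all $y\in C$ with $y=x$ on $[-h,t]$ that are Lipschitz continuous on $[t,T]$. A functional $\varphi$ is $ci$-differentiable at $(t,x)\in[0,T)\times C$ if there are $\partial_t\varphi(t,x)\in\mathbb R$ and $\nabla\varphi(t,x)\in\mathbb R^n$ (the $ci$-derivatives, which are then unique) such that for every $y\in\mathrm{Lip}(t,x)$ $$\varphi(\tau,y)-\varphi(t,x)=\partial_t\varphi(t,x)(\tau-t)+\langle\nabla\varphi(t,x),y(\tau)-x(t)\rangle+o(\tau-t)\quad\text{as }\tau\downarrow t,$$ where the $o$-term may depend on $y$. Let $H:[0,T]\times C\times\mathbb R^n\to\mathbb R$ and $\sigma:C\to\mathbb R$ be continuous, let $H(\cdot,\cdot,s)$ be non-anticipative for every $s\in\mathbb R^n$,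 and let $c>0$ be such that $$|H(t,x,s)-H(t,x,r)|\le c\Bigl(1+\max_{\xi\in[-h,t]}\|x(\xi)\|\Bigr)\|s-r\|\qquad\text{for all }t\in[0,T],\ x\in C,\ s,r\in\mathbb R^n.$$ Consider the Cauchy problem $$\partial_t\varphi(t,x)+H(t,x,\nabla\varphi(t,x))=0,\quad (t,x)\in[0,T)\times C,\tag{1}$$ $$\varphi(T,x)=\sigma(x),\quad x\in C.\tag{2}$$ A functional $\varphi:[0,T]\times C\to\mathbb R$ is called a minimax solution of (1), (2) if it is non-anticipative and continuous, satisfies (2), and for every $(t,x)\in[0,T)\times C$ and $s\in\mathbb R^n$ there is $y\in\mathrm{Lip}(t,x)$ with $\|\dot y(\tau)\|\le c\,(1+\max_{\xi\in[-h,\tau]}\|y(\xi)\|)$ for a.e. $\tau\in[t,T]$ and $$\varphi(\tau,y)-\varphi(t,x)=\langle s,y(\tau)-x(t)\rangle-\int_t^\tau H(\xi,y,s)\,d\xi\qquad\text{for all }\tau\in[t,T].$$ **Proposition.** If a continuous functional $\varphi:[0,T]\times C\to\mathbb R$ is $ci$-differentiable at every point of $[0,T)\times C$ and satisfies (1) and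 (2), then it is a minimax solution of (1), (2). -/

import Mathlib

open Set Filter Topology MeasureTheory Asymptotics
open scoped NNReal

noncomputable section

namespace PathHJ

/-- The Euclidean space `ℝⁿ`. -/
abbrev E (n : ℕ) := EuclideanSpace ℝ (Fin n)

/-- The Banach space `C([-h, T], ℝⁿ)` of continuous functions with the uniform norm. -/
abbrev Paths (h T : ℝ) (n : ℕ) := C(Icc (-h) T, E n)

variable {h T : ℝ} {n : ℕ}

/-- The value `x(τ)` of a path at a real time `τ ∈ [-h, T]`
(and `0` outside of `[-h, T]`, a value which is never used). -/
def val (x : Paths h T n) : ℝ → E n :=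
  Function.extend ((↑) : Icc (-h) T → ℝ) x 0

theorem val_of_mem (x : Paths h T n) {τ : ℝ} (hτ : τ ∈ Icc (-h) T) :
    val x τ = x ⟨τ, hτ⟩ :=
  Subtype.val_injective.extend_apply x 0 (⟨τ, hτ⟩ : Icc (-h) T)

theorem continuousOn_val (x : Paths h T n) : ContinuousOn (val x) (Icc (-h) T) := by
  rw [continuousOn_iff_continuous_domRestrict]
  have : (Icc (-h) T).domRestrict (val x) = x := by
    funext τ
    exact val_of_mem x τ.2
  rw [this]
  exact x.continuous

/-- `max_{ξ ∈ [-h, t]} ‖x(ξ)‖`. -/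
def maxNorm (x : Paths h T n) (t : ℝ) : ℝ :=
  sSup ((fun ξ => ‖val x ξ‖) '' Icc (-h) t)

/-- The supremum in `maxNorm` is an attained maximum. -/
theorem isGreatest_maxNorm (x : Paths h T n) {t : ℝ} (ht : t ∈ Icc (-h) T) :
    IsGreatest ((fun ξ => ‖val x ξ‖) '' Icc (-h) t) (maxNorm x t) := by
  refine IsCompact.isGreatest_sSup (isCompact_Icc.image_of_continuousOn ?_)
    ((nonempty_Icc.2 ht.1).image _)
  exact ((continuousOn_val x).mono (Icc_subset_Icc_right ht.2)).norm

/-- `x(τ) = y(τ)` for all `τ ∈ [-h, t]`. -/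
def AgreeUpTo (t : ℝ) (x y : Paths h T n) : Prop :=
  ∀ τ ∈ Icc (-h) t, val x τ = val y τ

/-- A functional on `[0, T] × C([-h, T], ℝⁿ)` is represented by a function
`φ : ℝ → Paths h T n → ℝ` of which only the values at times in `[0, T]` matter.
It is non-anticipative if `φ(t, x(·))` depends only on the restriction of `x(·)` to `[-h, t]`. -/
def NonAnticipative (φ : ℝ → Paths h T n → ℝ) : Prop :=
  ∀ t ∈ Ico 0 T, ∀ x y : Paths h T n, AgreeUpTo t x y → φ t x = φ t y

/-- Continuity of a functional on `[0, T] × C([-h, T], ℝⁿ)` with the product metric. -/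
def ContinuousFunctional (φ : ℝ → Paths h T n → ℝ) : Prop :=
  ContinuousOn (fun p : ℝ × Paths h T n => φ p.1 p.2) (Icc 0 T ×ˢ univ)

/-- Continuity of a Hamiltonian on `[0, T] × C([-h, T], ℝⁿ) × ℝⁿ`. -/
def ContinuousHamiltonian (H : ℝ → Paths h T n → E n → ℝ) : Prop :=
  ContinuousOn (fun p : ℝ × Paths h T n × E n => H p.1 p.2.1 p.2.2) (Icc 0 T ×ˢ univ)

/-- The Lipschitz condition on the Hamiltonian in the last variable, with constant `c`. -/
def HamiltonianLipschitz (c : ℝ) (H : ℝ → Paths h T n → E n → ℝ) : Prop :=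
  ∀ t ∈ Icc 0 T, ∀ (x : Paths h T n) (s r : E n),
    |H t x s - H t x r| ≤ c * (1 + maxNorm x t) * ‖s - r‖

/-- The set `Lip(t, x(·))` of the paths that coincide with `x(·)` on `[-h, t]` and are
Lipschitz continuous on `[t, T]`. -/
def Lip (t : ℝ) (x : Paths h T n) : Set (Paths h T n) :=
  {y | AgreeUpTo t x y ∧ ∃ K : ℝ≥0, LipschitzOnWith K (val y) (Icc t T)}

/-- `a ∈ ℝ` and `p ∈ ℝⁿ` are co-invariant derivatives of `φ` at `(t, x(·))`. -/
def HasCiDerivAt (φ : ℝ → Paths h T n → ℝ) (a : ℝ) (p : E n) (t : ℝ) (x : Paths h T n) : Prop :=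
  ∀ y ∈ Lip t x,
    (fun τ => φ τ y - φ t x - (a * (τ - t) + inner ℝ p (val y τ - val x t)))
      =o[𝓝[>] t] fun τ => τ - t

/-- Co-invariant differentiability at the point `(t, x(·))`. -/
def CiDifferentiableAt (φ : ℝ → Paths h T n → ℝ) (t : ℝ) (x : Paths h T n) : Prop :=
  ∃ (a : ℝ) (p : E n), HasCiDerivAt φ a p t x

open Classical in
/-- The co-invariant derivative `∂ₜφ(t, x(·))` (`0` if `φ` is not `ci`-differentiable there). -/
def ciDt (φ : ℝ → Paths h T n → ℝ) (t : ℝ) (x : Paths h T n) : ℝ :=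
  if hd : CiDifferentiableAt φ t x then hd.choose else 0

open Classical in
/-- The co-invariant derivative `∇φ(t, x(·))` (`0` if `φ` is not `ci`-differentiable there). -/
def ciGrad (φ : ℝ → Paths h T n → ℝ) (t : ℝ) (x : Paths h T n) : E n :=
  if hd : CiDifferentiableAt φ t x then hd.choose_spec.choose else 0

theorem CiDifferentiableAt.hasCiDerivAt {φ : ℝ → Paths h T n → ℝ} {t : ℝ} {x : Paths h T n}
    (hd : CiDifferentiableAt φ t x) : HasCiDerivAt φ (ciDt φ t x) (ciGrad φ t x) t x := by
  rw [ciDt, ciGrad, dif_pos hd, dif_pos hd]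
  exact hd.choose_spec.choose_spec

/-- The path that follows `x(·)` up to time `t` and then moves with the constant velocity `v`. -/
def linExt (t : ℝ) (ht : -h ≤ t) (x : Paths h T n) (v : E n) : Paths h T n where
  toFun ξ := x ⟨min ξ t, le_min ξ.2.1 ht, (min_le_left _ _).trans ξ.2.2⟩ + max ((ξ : ℝ) - t) 0 • v
  continuous_toFun := by fun_prop

theorem val_linExt_of_le {t : ℝ} (ht : -h ≤ t) (x : Paths h T n) (v : E n) {τ : ℝ}
    (h1 : t ≤ τ) (h2 : τ ≤ T) : val (linExt t ht x v) τ = val x t + (τ - t) • v := by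
  rw [val_of_mem _ ⟨ht.trans h1, h2⟩, val_of_mem _ ⟨ht, h1.trans h2⟩]
  simp [linExt, h1]

theorem linExt_mem_Lip {t : ℝ} (ht : -h ≤ t) (hT : t ≤ T) (x : Paths h T n) (v : E n) :
    linExt t ht x v ∈ Lip t x := by
  constructor
  · intro τ hτ
    have hm : τ ∈ Icc (-h) T := ⟨hτ.1, hτ.2.trans hT⟩
    rw [val_of_mem _ hm, val_of_mem _ hm]
    simp [linExt, hτ.2]
  · refine ⟨‖v‖₊, LipschitzOnWith.of_dist_le_mul fun a ha b hb => ?_⟩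
    rw [val_linExt_of_le ht x v ha.1 ha.2, val_linExt_of_le ht x v hb.1 hb.2, dist_add_left,
      dist_eq_norm, ← sub_smul, norm_smul, mul_comm, Real.dist_eq]
    simp

/-- Co-invariant derivatives are unique, so that `ciDt` and `ciGrad` do not depend on a choice. -/
theorem HasCiDerivAt.unique {φ : ℝ → Paths h T n → ℝ} {a b : ℝ} {p q : E n} {t : ℝ}
    {x : Paths h T n} (ht : -h ≤ t) (hT : t < T) (h1 : HasCiDerivAt φ a p t x)
    (h2 : HasCiDerivAt φ b q t x) : a = b ∧ p = q := by
  have key : ∀ v : E n, a - b + inner ℝ (p - q) v = 0 := by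
    intro v
    have h3 := (h2 _ (linExt_mem_Lip ht hT.le x v)).sub (h1 _ (linExt_mem_Lip ht hT.le x v))
    have h4 : (fun τ => (a - b + inner ℝ (p - q) v) * (τ - t)) =o[𝓝[>] t] fun τ => τ - t := by
      refine h3.congr' ?_ EventuallyEq.rfl
      filter_upwards [Ioc_mem_nhdsGT hT] with τ hτ
      rw [val_linExt_of_le ht x v hτ.1.le hτ.2, add_sub_cancel_left, inner_smul_right,
        inner_smul_right, inner_sub_left]
      ring
    have h5 : Tendsto (fun _ : ℝ => a - b + inner ℝ (p - q) v) (𝓝[>] t) (𝓝 0) := by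
      refine h4.tendsto_div_nhds_zero.congr' ?_
      filter_upwards [self_mem_nhdsWithin] with τ hτ
      exact mul_div_cancel_right₀ _ (sub_pos.2 hτ).ne'
    exact tendsto_nhds_unique tendsto_const_nhds h5
  have h0 : a - b = 0 := by simpa using key 0
  have hp : p - q = 0 := by
    have := key (p - q)
    rwa [h0, zero_add, inner_self_eq_zero] at this
  exact ⟨sub_eq_zero.1 h0, sub_eq_zero.1 hp⟩

/-- The Hamilton--Jacobi equation `∂ₜφ + H(t, x(·), ∇φ) = 0` on `[0, T) × C([-h, T], ℝⁿ)`. -/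
def SatisfiesHJ (H : ℝ → Paths h T n → E n → ℝ) (φ : ℝ → Paths h T n → ℝ) : Prop :=
  ∀ t ∈ Ico 0 T, ∀ x : Paths h T n, ciDt φ t x + H t x (ciGrad φ t x) = 0

/-- The boundary condition `φ(T, x(·)) = σ(x(·))`. -/
def SatisfiesBoundary (σ : Paths h T n → ℝ) (φ : ℝ → Paths h T n → ℝ) : Prop :=
  ∀ x : Paths h T n, φ T x = σ x

/-- The set `Y(t, x(·))` of `y(·) ∈ Lip(t, x(·))` with
`‖ẏ(τ)‖ ≤ c (1 + max_{ξ ∈ [-h, τ]} ‖y(ξ)‖)` for a.e. `τ ∈ [t, T]`. -/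
def Y (c t : ℝ) (x : Paths h T n) : Set (Paths h T n) :=
  {y | y ∈ Lip t x ∧ ∀ᵐ τ ∂(volume.restrict (Icc t T)),
    DifferentiableAt ℝ (val y) τ ∧ ‖deriv (val y) τ‖ ≤ c * (1 + maxNorm y τ)}

/-- Minimax solutions of the Cauchy problem for the Hamilton--Jacobi equation with Hamiltonian `H`
and boundary functional `σ`; `c` is the Lipschitz constant of the Hamiltonian. -/
structure IsMinimaxSolution (c : ℝ) (H : ℝ → Paths h T n → E n → ℝ) (σ : Paths h T n → ℝ)
    (φ : ℝ → Paths h T n → ℝ) : Prop where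
  nonAnticipative : NonAnticipative φ
  continuous : ContinuousFunctional φ
  boundary : SatisfiesBoundary σ φ
  exists_characteristic : ∀ t ∈ Ico 0 T, ∀ (x : Paths h T n) (s : E n), ∃ y ∈ Y c t x,
    ∀ τ ∈ Icc t T,
      φ τ y - φ t x = inner ℝ s (val y τ - val x t) - ∫ ξ in t..τ, H ξ y s

end PathHJ

end

namespace PathHJ

variable {h T : ℝ} {n : ℕ}

/-! Fix `(t, x)` and `s`, and measure by `defect` how far an extension of `x` is from satisfying the
characteristic identity. Continuing a path `y` from time `τ` with constant velocity `v` gives the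
defect accumulated since `τ` the right derivative `∂ₜφ + ⟨∇φ - s, v⟩ + H(τ, y, s)` at `τ`. The
Lipschitz condition on `H` provides a `v` of admissible norm with `⟨∇φ - s, v⟩ = H(τ, y, ∇φ) - H(τ,
y, s)`, and the equation then makes this derivative vanish (`exists_linExt_defect_isLittleO`).

Since `v` need not depend continuously on `y`, no differential equation is solved. Instead, real
induction in time concatenates such pieces into a path whose defect is at most `ε (ξ - t)`
(`exists_abs_defect_le`). Compactness of the set of speed-bounded extensions
(`isCompact_speedBounded`) handles the limit times of this induction and also the passage `ε → 0`
(`exists_defect_eq_zero`). -/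

/-! ### Evaluation, running maximum and agreement of paths -/

theorem val_of_notMem (x : Paths h T n) {τ : ℝ} (hτ : τ ∉ Icc (-h) T) : val x τ = 0 :=
  Function.extend_apply' _ _ _ fun ⟨a, ha⟩ => hτ (ha ▸ a.2)

theorem norm_val_sub_val_le (x y : Paths h T n) (τ : ℝ) : ‖val x τ - val y τ‖ ≤ ‖x - y‖ := by
  by_cases hτ : τ ∈ Icc (-h) T
  · rw [val_of_mem x hτ, val_of_mem y hτ]
    exact (x - y).norm_coe_le_norm _
  · simp [val_of_notMem _ hτ]

theorem continuous_val_apply (τ : ℝ) : Continuous fun x : Paths h T n => val x τ := by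
  refine (LipschitzWith.of_dist_le_mul (K := 1) fun x y => ?_).continuous
  simpa [dist_eq_norm] using norm_val_sub_val_le x y τ

theorem norm_val_le_maxNorm (x : Paths h T n) {τ t : ℝ} (ht : t ≤ T) (hτ : τ ∈ Icc (-h) t) :
    ‖val x τ‖ ≤ maxNorm x t :=
  (isGreatest_maxNorm x ⟨hτ.1.trans hτ.2, ht⟩).2 ⟨τ, hτ, rfl⟩

theorem maxNorm_le {x : Paths h T n} {t M : ℝ} (ht : t ∈ Icc (-h) T)
    (hM : ∀ τ ∈ Icc (-h) t, ‖val x τ‖ ≤ M) : maxNorm x t ≤ M := by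
  obtain ⟨τ, hτ, he⟩ := (isGreatest_maxNorm x ht).1
  exact he ▸ hM τ hτ

theorem maxNorm_nonneg (x : Paths h T n) {t : ℝ} (ht : t ∈ Icc (-h) T) : 0 ≤ maxNorm x t :=
  (norm_nonneg _).trans (norm_val_le_maxNorm x ht.2 ⟨ht.1, le_rfl⟩)

theorem maxNorm_mono (x : Paths h T n) {a b : ℝ} (ha : -h ≤ a) (hab : a ≤ b) (hb : b ≤ T) :
    maxNorm x a ≤ maxNorm x b :=
  maxNorm_le ⟨ha, hab.trans hb⟩ fun _ hτ => norm_val_le_maxNorm x hb ⟨hτ.1, hτ.2.trans hab⟩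

theorem continuous_maxNorm {t : ℝ} (ht : t ∈ Icc (-h) T) :
    Continuous fun x : Paths h T n => maxNorm x t := by
  have key : ∀ x y : Paths h T n, maxNorm x t ≤ maxNorm y t + ‖x - y‖ := fun x y =>
    maxNorm_le ht fun τ hτ => by
      have h1 := norm_val_le_maxNorm y ht.2 hτ
      have h2 := norm_val_sub_val_le x y τ
      have h3 := norm_le_insert' (val x τ) (val y τ)
      linarith
  refine (LipschitzWith.of_dist_le_mul (K := 1) fun x y => ?_).continuous
  rw [Real.dist_eq, NNReal.coe_one, one_mul, dist_eq_norm, abs_le]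
  have h1 := key x y
  have h2 := key y x
  rw [norm_sub_rev] at h2
  constructor <;> linarith

theorem AgreeUpTo.symm {t : ℝ} {x y : Paths h T n} (hxy : AgreeUpTo t x y) : AgreeUpTo t y x :=
  fun τ hτ => (hxy τ hτ).symm

theorem AgreeUpTo.trans {t : ℝ} {x y z : Paths h T n} (hxy : AgreeUpTo t x y)
    (hyz : AgreeUpTo t y z) : AgreeUpTo t x z :=
  fun τ hτ => (hxy τ hτ).trans (hyz τ hτ)

theorem AgreeUpTo.mono {s t : ℝ} {x y : Paths h T n} (hst : s ≤ t) (hxy : AgreeUpTo t x y) :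
    AgreeUpTo s x y :=
  fun τ hτ => hxy τ ⟨hτ.1, hτ.2.trans hst⟩

theorem AgreeUpTo.maxNorm_eq {t : ℝ} {x y : Paths h T n} (hxy : AgreeUpTo t x y) :
    maxNorm x t = maxNorm y t := by
  unfold maxNorm
  congr 1
  exact image_congr fun τ hτ => by rw [hxy τ hτ]

/-! ### Non-anticipativity -/

/-- A co-invariantly differentiable continuous functional is non-anticipative. -/
theorem nonAnticipative_of_ciDifferentiableAt (hh : 0 ≤ h) {φ : ℝ → Paths h T n → ℝ}
    (hφ : ContinuousFunctional φ) (hd : ∀ t ∈ Ico 0 T, ∀ x, CiDifferentiableAt φ t x) :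
    NonAnticipative φ := by
  -- As `τ ↓ t`, `φ τ y` tends to `φ t x` by the `ci`-expansion at `(t, x)`, and to `φ t y` by
  -- continuity.
  have key : ∀ t ∈ Ico 0 T, ∀ x : Paths h T n, ∀ y ∈ Lip t x, φ t x = φ t y := by
    intro t ht x y hy
    have htm : t ∈ Icc 0 T := Ico_subset_Icc_self ht
    have hIoc : Ioc t T ∈ 𝓝[>] t := Ioc_mem_nhdsGT ht.2
    obtain ⟨a, p, hap⟩ := hd t ht x
    have hsub : Tendsto (fun τ => τ - t) (𝓝[>] t) (𝓝 0) := by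
      have : Tendsto (fun τ => τ - t) (𝓝 t) (𝓝 (t - t)) := by
        exact (continuous_id.sub continuous_const).tendsto t
      rw [sub_self] at this
      exact this.mono_left nhdsWithin_le_nhds
    have hval : Tendsto (fun τ => val y τ - val x t) (𝓝[>] t) (𝓝 0) := by
      have h1 : Tendsto (val y) (𝓝[>] t) (𝓝 (val y t)) := by
        refine (continuousOn_val y t ⟨by linarith [ht.1], ht.2.le⟩).mono_left ?_
        refine nhdsWithin_le_of_mem (mem_of_superset hIoc fun τ hτ => ⟨?_, hτ.2⟩)
        linarith [ht.1, hτ.1]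
      rw [← hy.1 t ⟨by linarith [ht.1], le_rfl⟩] at h1
      simpa using h1.sub_const (val x t)
    have h0 := (hap y hy).trans_tendsto hsub
    have h1 : Tendsto (fun τ => a * (τ - t) + inner ℝ p (val y τ - val x t)) (𝓝[>] t)
        (𝓝 (a * 0 + inner ℝ p 0)) := (hsub.const_mul a).add (tendsto_const_nhds.inner hval)
    have h2 : Tendsto (fun τ => φ τ y) (𝓝[>] t) (𝓝 (φ t x)) := by
      have := (h0.add h1).add_const (φ t x)
      simpa using this
    have h3 : Tendsto (fun τ => φ τ y) (𝓝[>] t) (𝓝 (φ t y)) := by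
      have hc : ContinuousWithinAt (fun τ => φ τ y) (Icc 0 T) t :=
        (hφ (t, y) ⟨htm, mem_univ _⟩).comp (f := fun τ => (τ, y))
          (by fun_prop) fun τ hτ => ⟨hτ, mem_univ _⟩
      refine hc.mono_left (nhdsWithin_le_of_mem (mem_of_superset hIoc fun τ hτ => ⟨?_, hτ.2⟩))
      linarith [ht.1, hτ.1]
    exact tendsto_nhds_unique h2 h3
  intro t ht x y hxy
  have hth : -h ≤ t := by linarith [ht.1]
  -- Neither path need be Lipschitz after `t`; the extension of `x` frozen at time `t` lies in both
  -- `Lip t x` and `Lip t y`.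
  have hz := linExt_mem_Lip hth ht.2.le x (0 : E n)
  rw [key t ht x _ hz, key t ht y _ ⟨hxy.symm.trans hz.1, hz.2⟩]

/-! ### Compactness of the speed-bounded extensions -/

/-- The extensions `y` of `x` after the time `t` whose speed at each time `τ` is at most
`c (1 + max_{ξ ∈ [-h, τ]} ‖y(ξ)‖)`. -/
def SpeedBounded (c t : ℝ) (x : Paths h T n) : Set (Paths h T n) :=
  {y | AgreeUpTo t x y ∧ ∀ a b, t ≤ a → a ≤ b → b ≤ T →
    ‖val y b - val y a‖ ≤ c * (1 + maxNorm y b) * (b - a)}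

/-- With increments in place of derivatives, every condition is a non-strict relation between
continuous functions of the path, so it survives uniform limits. -/
theorem isClosed_speedBounded (c : ℝ) {t : ℝ} (ht : -h ≤ t) (x : Paths h T n) :
    IsClosed (SpeedBounded c t x) := by
  simp only [SpeedBounded, AgreeUpTo, ofPred_and, ofPred_forall]
  refine (isClosed_biInter fun τ _ => isClosed_eq continuous_const (continuous_val_apply τ)).inter
    (isClosed_iInter fun a => isClosed_iInter fun b => isClosed_iInter fun ha =>
      isClosed_iInter fun hab => isClosed_iInter fun hb => isClosed_le ?_ ?_)
  · exact ((continuous_val_apply b).sub (continuous_val_apply a)).norm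
  · exact (continuous_const.mul (continuous_const.add
      (continuous_maxNorm ⟨by linarith, hb⟩))).mul continuous_const

/-- If the maximum up to `b` is attained after `a`, the increment since `a` is at most half of `1 +
maxNorm y b` and is absorbed into the left side. -/
theorem one_add_maxNorm_le_two_mul {c t : ℝ} (hc : 0 < c) (ht : -h ≤ t) {x y : Paths h T n}
    (hy : y ∈ SpeedBounded c t x) {a b : ℝ} (ha : t ≤ a) (hab : a ≤ b) (hb : b ≤ T)
    (hd : c * (b - a) ≤ 1 / 2) : 1 + maxNorm y b ≤ 2 * (1 + maxNorm y a) := by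
  have hbm : b ∈ Icc (-h) T := ⟨by linarith, hb⟩
  have ham : a ∈ Icc (-h) T := ⟨by linarith, by linarith⟩
  have h0 := maxNorm_nonneg y hbm
  obtain ⟨ξ, hξ, he⟩ := (isGreatest_maxNorm y hbm).1
  have hm := maxNorm_nonneg y ham
  rcases le_total ξ a with hξa | hξa
  · have := norm_val_le_maxNorm y ham.2 ⟨hξ.1, hξa⟩
    simp only at he
    linarith
  · have h1 := hy.2 a ξ ha hξa (hξ.2.trans hb)
    have h2 := norm_val_le_maxNorm y ham.2 ⟨ham.1, le_rfl⟩
    have h3 := norm_le_insert' (val y ξ) (val y a)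
    have h4 := maxNorm_mono y hξ.1 hξ.2 hb
    have h5 : c * (1 + maxNorm y ξ) * (ξ - a) ≤ (1 + maxNorm y b) * (1 / 2) := by
      have h6 : (1 + maxNorm y ξ) * (c * (ξ - a)) ≤ (1 + maxNorm y b) * (1 / 2) := by
        refine mul_le_mul (by linarith) ?_ ?_ (by linarith)
        · have := mul_le_mul_of_nonneg_left (sub_le_sub_right hξ.2 a) hc.le
          linarith
        · exact mul_nonneg hc.le (by linarith)
      linarith
    simp only at he
    linarith

/-- A discrete Grönwall estimate: `1 + maxNorm` at most doubles over each time step of length `1 /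
(2c)`, and finitely many steps reach `T`. -/
theorem exists_maxNorm_le {c t : ℝ} (hc : 0 < c) (ht : t ∈ Icc (-h) T) (x : Paths h T n) :
    ∃ M, 0 ≤ M ∧ ∀ y ∈ SpeedBounded c t x, maxNorm y T ≤ M := by
  set d := 1 / (2 * c) with hd
  have hcd : c * d = 1 / 2 := by rw [hd]; field_simp
  have hd0 : 0 < d := by positivity
  have key : ∀ y ∈ SpeedBounded c t x, ∀ k : ℕ,
      1 + maxNorm y (min (t + k * d) T) ≤ 2 ^ k * (1 + maxNorm x t) := by
    intro y hy k
    induction k with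
    | zero => simp [ht.2, hy.1.maxNorm_eq]
    | succ k ih =>
      have hle : min (t + k * d) T ≤ min (t + (k + 1 : ℕ) * d) T :=
        min_le_min_right _ (by push_cast; linarith)
      have hsub : min (t + (k + 1 : ℕ) * d) T - min (t + k * d) T ≤ d := by
        rcases le_total (t + k * d) T with h1 | h1
        · rw [min_eq_left h1]
          have := min_le_left (t + (k + 1 : ℕ) * d) T
          push_cast at this ⊢
          linarith
        · rw [min_eq_right h1]
          have := min_le_right (t + (k + 1 : ℕ) * d) T
          linarith
      have := one_add_maxNorm_le_two_mul hc ht.1 hy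
        (le_min (le_add_of_nonneg_right (by positivity)) ht.2) hle (min_le_right _ _)
        (hcd ▸ mul_le_mul_of_nonneg_left hsub hc.le)
      rw [pow_succ]
      linarith
  obtain ⟨k, hk⟩ := exists_nat_ge ((T - t) / d)
  rw [div_le_iff₀ hd0] at hk
  have h0 := maxNorm_nonneg x ht
  refine ⟨2 ^ k * (1 + maxNorm x t), by positivity, fun y hy => ?_⟩
  have := key y hy k
  rw [min_eq_right (by linarith)] at this
  linarith

theorem SpeedBounded.dist_le {c t : ℝ} (hc : 0 ≤ c) (ht : t ∈ Icc (-h) T) {x y : Paths h T n}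
    (hy : y ∈ SpeedBounded c t x) {M : ℝ} (hM : maxNorm y T ≤ M) {a b : ℝ}
    (ha : a ∈ Icc t T) (hb : b ∈ Icc t T) : dist (val y a) (val y b) ≤ c * (1 + M) * dist a b := by
  wlog hab : a ≤ b generalizing a b
  · rw [dist_comm, dist_comm a]
    exact this hb ha (le_of_not_ge hab)
  rw [dist_comm, dist_eq_norm, dist_comm, Real.dist_eq, abs_of_nonneg (sub_nonneg.2 hab)]
  have h1 := maxNorm_mono y (ht.1.trans hb.1) hb.2 le_rfl
  refine (hy.2 a b ha.1 hab hb.2).trans (mul_le_mul_of_nonneg_right ?_ (sub_nonneg.2 hab))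
  exact mul_le_mul_of_nonneg_left (by linarith) hc

/-- Arzelà–Ascoli: the uniform bound `M` also gives the common Lipschitz constant `c (1 + M)` after
`t`, while before `t` all the paths equal `x`. -/
theorem isCompact_speedBounded {c t : ℝ} (hc : 0 < c) (ht : t ∈ Icc (-h) T) (x : Paths h T n) :
    IsCompact (SpeedBounded c t x) := by
  obtain ⟨M, hM0, hM⟩ := exists_maxNorm_le hc ht x
  have hK : 0 ≤ c * (1 + M) := by positivity
  let e := ContinuousMap.isometryEquivBoundedOfCompact (Icc (-h) T) (E n)
  suffices IsCompact (e.symm ⁻¹' SpeedBounded c t x) from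
    (e.symm.toHomeomorph.isCompact_preimage).1 this
  refine BoundedContinuousFunction.arzela_ascoli₂ (Metric.closedBall 0 M)
    (isCompact_closedBall _ _) _
    ((isClosed_speedBounded c ht.1 x).preimage e.symm.continuous) ?_ ?_
  · intro f τ hf
    have h1 := hM _ hf
    have h2 := norm_val_le_maxNorm (e.symm f) le_rfl τ.2
    rw [val_of_mem _ τ.2] at h2
    rw [mem_closedBall_zero_iff]
    exact h2.trans h1
  · intro τ₀
    rw [Metric.equicontinuousAt_iff]
    intro ε hε
    have hx : ∀ᶠ τ : Icc (-h) T in 𝓝 τ₀,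
        dist (val x (min (τ₀ : ℝ) t)) (val x (min (τ : ℝ) t)) < ε / 2 := by
      have hc : Continuous fun τ : Icc (-h) T => val x (min (τ : ℝ) t) :=
        (continuousOn_val x).comp_continuous (by fun_prop)
          fun τ => ⟨le_min τ.2.1 ht.1, (min_le_left _ _).trans τ.2.2⟩
      have := Metric.tendsto_nhds.1 (hc.tendsto τ₀) (ε / 2) (half_pos hε)
      simpa only [dist_comm] using this
    have hl : ∀ᶠ τ : Icc (-h) T in 𝓝 τ₀, c * (1 + M) * dist (τ₀ : ℝ) τ < ε / 2 := by
      have hc : Continuous fun τ : Icc (-h) T => c * (1 + M) * dist (τ₀ : ℝ) τ := by fun_prop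
      exact hc.tendsto τ₀ (Iio_mem_nhds (by simpa using hε))
    obtain ⟨δ, hδ, hball⟩ := Metric.eventually_nhds_iff.1 (hx.and hl)
    refine ⟨δ, hδ, fun τ hτ f => ?_⟩
    obtain ⟨h1, h2⟩ := hball hτ
    set y := e.symm f.1 with hy
    have hyZ : y ∈ SpeedBounded c t x := f.2
    -- Splitting at `t` into the fixed path stopped at `t` and a Lipschitz increment avoids a case
    -- distinction on the positions of `τ₀` and `τ`.
    have hdec : ∀ τ : Icc (-h) T, f.1 τ = val x (min (τ : ℝ) t) +
        (val y (max (τ : ℝ) t) - val y t) := by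
      intro τ
      have hv : f.1 τ = val y τ := (val_of_mem y τ.2).symm
      rw [hv]
      rcases le_total (τ : ℝ) t with h3 | h3
      · rw [min_eq_left h3, max_eq_right h3, sub_self, add_zero, hyZ.1 τ ⟨τ.2.1, h3⟩]
      · rw [min_eq_right h3, max_eq_left h3, hyZ.1 t ⟨ht.1, le_rfl⟩]
        abel
    have h3 := SpeedBounded.dist_le hc.le ht hyZ (hM y hyZ)
      (a := max (τ₀ : ℝ) t) (b := max (τ : ℝ) t)
      ⟨le_max_right _ _, max_le τ₀.2.2 ht.2⟩ ⟨le_max_right _ _, max_le τ.2.2 ht.2⟩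
    have h4 : dist (max (τ₀ : ℝ) t) (max (τ : ℝ) t) ≤ dist (τ₀ : ℝ) τ := by
      simpa [Real.dist_eq] using abs_max_sub_max_le_abs (τ₀ : ℝ) τ t
    have h5 := mul_le_mul_of_nonneg_left h4 hK
    change dist (f.1 τ₀) (f.1 τ) < ε
    rw [hdec τ₀, hdec τ]
    refine (dist_add_add_le _ _ _ _).trans_lt ?_
    rw [dist_sub_right]
    linarith

theorem agreeUpTo_linExt {t : ℝ} (ht : -h ≤ t) (hT : t ≤ T) (x : Paths h T n) (v : E n) :
    AgreeUpTo t x (linExt t ht x v) :=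
  (linExt_mem_Lip ht hT x v).1

theorem linExt_mem_speedBounded {c t τ : ℝ} (hc : 0 < c) (ht : -h ≤ t) (htτ : t ≤ τ) (hτ : τ ≤ T)
    {x y : Paths h T n} (hy : AgreeUpTo t x y) (hyτ : ∀ a b, t ≤ a → a ≤ b → b ≤ τ →
      ‖val y b - val y a‖ ≤ c * (1 + maxNorm y b) * (b - a))
    {v : E n} (hv : ‖v‖ ≤ c * (1 + maxNorm y τ)) :
    linExt τ (ht.trans htτ) y v ∈ SpeedBounded c t x := by
  have hag := agreeUpTo_linExt (ht.trans htτ) hτ y v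
  set z := linExt τ (ht.trans htτ) y v with hz
  refine ⟨hy.trans (hag.mono htτ), ?_⟩
  have hbefore : ∀ a b, t ≤ a → a ≤ b → b ≤ τ →
      ‖val z b - val z a‖ ≤ c * (1 + maxNorm z b) * (b - a) := by
    intro a b ha hab hb
    rw [← hag b ⟨by linarith, hb⟩, ← hag a ⟨by linarith, by linarith⟩,
      ← (hag.mono hb).maxNorm_eq]
    exact hyτ a b ha hab hb
  have hafter : ∀ a b, τ ≤ a → a ≤ b → b ≤ T →
      ‖val z b - val z a‖ ≤ c * (1 + maxNorm z b) * (b - a) := by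
    intro a b ha hab hb
    rw [hz, val_linExt_of_le _ y v (ha.trans hab) hb, val_linExt_of_le _ y v ha (hab.trans hb),
      add_sub_add_left_eq_sub, ← sub_smul, sub_sub_sub_cancel_right, norm_smul, Real.norm_eq_abs,
      abs_of_nonneg (sub_nonneg.2 hab), mul_comm, ← hz]
    refine mul_le_mul_of_nonneg_right (hv.trans ?_) (sub_nonneg.2 hab)
    rw [hag.maxNorm_eq]
    have := maxNorm_mono z (ht.trans htτ) (ha.trans hab) hb
    exact mul_le_mul_of_nonneg_left (by linarith) hc.le
  intro a b ha hab hb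
  rcases le_total b τ with h1 | h1
  · exact hbefore a b ha hab h1
  rcases le_total τ a with h2 | h2
  · exact hafter a b h2 hab hb
  have h3 := hbefore a τ ha h2 le_rfl
  have h4 := hafter τ b le_rfl h1 hb
  have h5 : c * (1 + maxNorm z τ) * (τ - a) ≤ c * (1 + maxNorm z b) * (τ - a) := by
    have := maxNorm_mono z (ht.trans htτ) h1 hb
    exact mul_le_mul_of_nonneg_right (mul_le_mul_of_nonneg_left (by linarith) hc.le)
      (sub_nonneg.2 h2)
  have h6 := norm_sub_le_norm_sub_add_norm_sub (val z b) (val z τ) (val z a)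
  linarith

/-- Rademacher's theorem gives differentiability almost everywhere, and the increment bound passes
to the derivative. -/
theorem speedBounded_subset_Y {c t : ℝ} (hc : 0 < c) (ht : t ∈ Icc (-h) T) (x : Paths h T n) :
    SpeedBounded c t x ⊆ Y c t x := by
  intro y hy
  have h0 := maxNorm_nonneg y (t := T) ⟨ht.1.trans ht.2, le_rfl⟩
  have hlip : LipschitzOnWith (c * (1 + maxNorm y T)).toNNReal (val y) (Icc t T) := by
    refine LipschitzOnWith.of_dist_le_mul fun a ha b hb => ?_
    rw [Real.coe_toNNReal _ (by positivity)]
    exact SpeedBounded.dist_le hc.le ht hy le_rfl ha hb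
  refine ⟨⟨hy.1, _, hlip⟩, ?_⟩
  rw [← restrict_Ioo_eq_restrict_Icc]
  have hae := ae_restrict_mem (μ := volume) (measurableSet_Ioo (a := t) (b := T))
  have hdiff := (hlip.mono Ioo_subset_Icc_self).ae_differentiableWithinAt (μ := volume)
    measurableSet_Ioo
  filter_upwards [hdiff, hae] with τ hd hτ
  have hdτ : DifferentiableAt ℝ (val y) τ := hd.differentiableAt (Ioo_mem_nhds hτ.1 hτ.2)
  refine ⟨hdτ, ?_⟩
  -- Slopes are taken from the left: then `τ` is the right endpoint, where the increment bound has
  -- exactly `maxNorm y τ`.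
  have hlim := (hasDerivAt_iff_tendsto_slope.1 hdτ.hasDerivAt).mono_left
    (nhdsWithin_mono (s := Iio τ) τ fun a ha => ne_of_lt ha)
  refine le_of_tendsto hlim.norm ?_
  filter_upwards [Ioo_mem_nhdsLT hτ.1] with a ha
  have hpos : 0 < τ - a := sub_pos.2 ha.2
  rw [slope_comm, slope_def_module, norm_smul, norm_inv, Real.norm_eq_abs, abs_of_pos hpos,
    inv_mul_le_iff₀ hpos, mul_comm (τ - a)]
  exact hy.2 a τ ha.1.le ha.2.le hτ.2.le

/-! ### The defect: continuity and additivity in time -/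

/-- The amount by which the path `y` violates the equality in the definition of a minimax solution
at the time `ξ`. -/
noncomputable def defect (H : ℝ → Paths h T n → E n → ℝ) (φ : ℝ → Paths h T n → ℝ) (s : E n) (t : ℝ)
    (x y : Paths h T n) (ξ : ℝ) : ℝ :=
  φ ξ y - φ t x - inner ℝ s (val y ξ - val x t) + ∫ r in t..ξ, H r y s

/-- Clamping time to `[0, T]` makes the integrand continuous on all of `ℝ` without changing
integrals inside `[0, T]`. -/
theorem ContinuousHamiltonian.continuous_comp_projIcc {H : ℝ → Paths h T n → E n → ℝ}
    (hH : ContinuousHamiltonian H) (hT : 0 ≤ T) (s : E n) :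
    Continuous fun q : Paths h T n × ℝ => H (projIcc 0 T hT q.2) q.1 s :=
  ContinuousOn.comp_continuous (f := fun q : Paths h T n × ℝ => ((projIcc 0 T hT q.2 : ℝ), q.1, s))
    hH (by have := continuous_projIcc (a := (0 : ℝ)) (h := hT); fun_prop)
    fun q => ⟨(projIcc 0 T hT q.2).2, mem_univ _⟩

theorem integral_projIcc (H : ℝ → Paths h T n → E n → ℝ) (hT : 0 ≤ T) (s : E n)
    (y : Paths h T n) {a b : ℝ} (ha : a ∈ Icc 0 T) (hb : b ∈ Icc 0 T) :
    ∫ r in a..b, H (projIcc 0 T hT r) y s = ∫ r in a..b, H r y s :=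
  intervalIntegral.integral_congr fun r hr => by
    simp only [projIcc_of_mem hT (uIcc_subset_Icc ha hb hr)]

theorem ContinuousHamiltonian.intervalIntegrable {H : ℝ → Paths h T n → E n → ℝ}
    (hH : ContinuousHamiltonian H) (s : E n) (y : Paths h T n) {a b : ℝ}
    (ha : a ∈ Icc 0 T) (hb : b ∈ Icc 0 T) :
    IntervalIntegrable (fun r => H r y s) volume a b := by
  refine ContinuousOn.intervalIntegrable ?_
  exact ContinuousOn.comp (f := fun r : ℝ => (r, y, s)) hH (by fun_prop)
    fun r hr => ⟨uIcc_subset_Icc ha hb hr, mem_univ _⟩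

theorem continuousOn_defect {H : ℝ → Paths h T n → E n → ℝ} (hH : ContinuousHamiltonian H)
    {φ : ℝ → Paths h T n → ℝ} (hφ : ContinuousFunctional φ) (hh : 0 ≤ h) (s : E n) {t : ℝ}
    (ht : t ∈ Icc 0 T) (x : Paths h T n) {K : Set (Paths h T n)} (hK : IsCompact K) :
    ContinuousOn (fun p : ℝ × Paths h T n => defect H φ s t x p.2 p.1) (Icc t T ×ˢ K) := by
  have hT : 0 ≤ T := ht.1.trans ht.2
  have hsub : Icc t T ⊆ Icc 0 T := Icc_subset_Icc_left ht.1
  have hval : ContinuousOn (fun p : ℝ × Paths h T n => val p.2 p.1) (Icc t T ×ˢ K) := by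
    rw [continuousOn_iff_continuous_domRestrict]
    have hm : ∀ q : ↥(Icc t T ×ˢ K), q.1.1 ∈ Icc (-h) T := fun q =>
      ⟨by linarith [ht.1, q.2.1.1], q.2.1.2⟩
    have : (Icc t T ×ˢ K).domRestrict (fun p : ℝ × Paths h T n => val p.2 p.1) =
        fun q => q.1.2 ⟨q.1.1, hm q⟩ := by
      funext q
      exact val_of_mem _ (hm q)
    rw [this]
    fun_prop
  have hint : ContinuousOn (fun p : ℝ × Paths h T n => ∫ r in t..p.1, H r p.2 s)
      (Icc t T ×ˢ K) := by
    -- Compactness of `K` enters only here, for joint continuity of the integral in the path and the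
    -- upper limit.
    have : CompactSpace K := isCompact_iff_compactSpace.1 hK
    have hc : Continuous fun q : K × ℝ => ∫ r in t..q.2, H (projIcc 0 T hT r) q.1 s := by
      refine intervalIntegral.continuous_parametric_primitive_of_continuous
        (f := fun (y : K) r => H (projIcc 0 T hT r) y s) ?_
      exact (hH.continuous_comp_projIcc hT s).comp
        (f := fun q : K × ℝ => ((q.1 : Paths h T n), q.2)) (by fun_prop)
    rw [continuousOn_iff_continuous_domRestrict]
    have : (Icc t T ×ˢ K).domRestrict (fun p : ℝ × Paths h T n => ∫ r in t..p.1, H r p.2 s) =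
        (fun q : K × ℝ => ∫ r in t..q.2, H (projIcc 0 T hT r) q.1 s) ∘
          fun q => (⟨q.1.2, q.2.2⟩, q.1.1) := by
      funext q
      exact (integral_projIcc H hT s q.1.2 ht (hsub q.2.1)).symm
    rw [this]
    exact hc.comp (by fun_prop)
  have hφ' : ContinuousOn (fun p : ℝ × Paths h T n => φ p.1 p.2) (Icc t T ×ˢ K) :=
    hφ.mono (prod_mono hsub (subset_univ _))
  exact ((hφ'.sub continuousOn_const).sub
    (continuousOn_const.inner (hval.sub continuousOn_const))).add hint

theorem integral_congr_of_agreeUpTo {H : ℝ → Paths h T n → E n → ℝ} {s : E n}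
    (hH : NonAnticipative fun t x => H t x s) {t ξ : ℝ} (ht : 0 ≤ t) (htξ : t ≤ ξ) (hξ : ξ < T)
    {y z : Paths h T n} (hyz : AgreeUpTo ξ y z) :
    ∫ r in t..ξ, H r y s = ∫ r in t..ξ, H r z s := by
  refine intervalIntegral.integral_congr fun r hr => ?_
  rw [uIcc_of_le htξ] at hr
  exact hH r ⟨ht.trans hr.1, hr.2.trans_lt hξ⟩ y z (hyz.mono hr.2)

theorem defect_congr {H : ℝ → Paths h T n → E n → ℝ} {s : E n}
    (hH : NonAnticipative fun t x => H t x s) {φ : ℝ → Paths h T n → ℝ} (hφ : NonAnticipative φ)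
    (hh : 0 ≤ h) {t ξ : ℝ} (ht : 0 ≤ t) (htξ : t ≤ ξ) (hξ : ξ < T) (x : Paths h T n)
    {y z : Paths h T n} (hyz : AgreeUpTo ξ y z) :
    defect H φ s t x y ξ = defect H φ s t x z ξ := by
  rw [defect, defect, hφ ξ ⟨ht.trans htξ, hξ⟩ y z hyz, hyz ξ ⟨by linarith, le_rfl⟩,
    integral_congr_of_agreeUpTo hH ht htξ hξ hyz]

/-- This cocycle identity lets errors of concatenated pieces add up. The point values of `φ` at `τ`
cancel when written with the same path `y`, so only `H` has to be non-anticipative. -/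
theorem defect_add {H : ℝ → Paths h T n → E n → ℝ} {s : E n}
    (hH : NonAnticipative fun t x => H t x s) (hHc : ContinuousHamiltonian H)
    (φ : ℝ → Paths h T n → ℝ) {t τ ξ : ℝ} (ht : 0 ≤ t) (htτ : t ≤ τ) (hτξ : τ ≤ ξ)
    (hτ : τ < T) (hξ : ξ ≤ T) (x : Paths h T n) {y z : Paths h T n} (hyz : AgreeUpTo τ y z) :
    defect H φ s t x z ξ = defect H φ s t x y τ + defect H φ s τ y z ξ := by
  have htm : t ∈ Icc 0 T := ⟨ht, by linarith⟩
  have hτm : τ ∈ Icc 0 T := ⟨by linarith, hτ.le⟩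
  have hξm : ξ ∈ Icc 0 T := ⟨by linarith, hξ⟩
  have hadd := intervalIntegral.integral_add_adjacent_intervals
    (hHc.intervalIntegrable s z htm hτm) (hHc.intervalIntegrable s z hτm hξm)
  rw [defect, defect, defect, ← hadd, integral_congr_of_agreeUpTo hH ht htτ hτ hyz,
    inner_sub_right, inner_sub_right, inner_sub_right]
  ring

/-! ### Infinitesimal step -/

/-- A velocity along which the two sides of the Hamilton--Jacobi equation balance. -/
theorem exists_velocity {V : Type*} [NormedAddCommGroup V] [InnerProductSpace ℝ V] (w : V)
    {d L : ℝ} (hL : 0 ≤ L) (hd : |d| ≤ L * ‖w‖) : ∃ v : V, ‖v‖ ≤ L ∧ inner ℝ w v = d := by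
  rcases eq_or_ne w 0 with rfl | hw
  · refine ⟨0, by simpa using hL, ?_⟩
    rw [norm_zero, mul_zero] at hd
    rw [inner_zero_right, abs_nonpos_iff.1 hd]
  · have hw' : 0 < ‖w‖ := norm_pos_iff.2 hw
    refine ⟨(d / ‖w‖ ^ 2) • w, ?_, ?_⟩
    · rw [norm_smul, Real.norm_eq_abs, abs_div, abs_of_pos (pow_pos hw' 2), div_mul_eq_mul_div,
        div_le_iff₀ (pow_pos hw' 2), pow_two, ← mul_assoc]
      exact mul_le_mul_of_nonneg_right hd hw'.le
    · rw [inner_smul_right, real_inner_self_eq_norm_sq, div_mul_cancel₀ _ (pow_pos hw' 2).ne']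

theorem exists_linExt_defect_isLittleO {c : ℝ} (hc : 0 < c)
    {H : ℝ → Paths h T n → E n → ℝ} (hH : ∀ s, NonAnticipative fun t x => H t x s)
    (hHc : ContinuousHamiltonian H) (hHl : HamiltonianLipschitz c H) {φ : ℝ → Paths h T n → ℝ}
    (hd : ∀ t ∈ Ico 0 T, ∀ x, CiDifferentiableAt φ t x) (hHJ : SatisfiesHJ H φ)
    (s : E n) {τ : ℝ} (hτ : τ ∈ Ico 0 T) (hτh : -h ≤ τ) (y : Paths h T n) :
    ∃ v, ‖v‖ ≤ c * (1 + maxNorm y τ) ∧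
      defect H φ s τ y (linExt τ hτh y v) =o[𝓝[>] τ] fun ξ => ξ - τ := by
  have hT : 0 ≤ T := hτ.1.trans hτ.2.le
  have hτm : τ ∈ Icc 0 T := Ico_subset_Icc_self hτ
  set a := ciDt φ τ y with ha
  set p := ciGrad φ τ y with hp
  have hm := maxNorm_nonneg y ⟨hτh, hτ.2.le⟩
  -- The Lipschitz condition at the momenta `p` and `s` is exactly the solvability condition for a
  -- velocity within the speed bound.
  obtain ⟨v, hv, hpv⟩ := exists_velocity (p - s) (by positivity) (hHl τ hτm y p s)
  refine ⟨v, hv, ?_⟩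
  have hag := agreeUpTo_linExt hτh hτ.2.le y v
  have h1 := (hd τ hτ y).hasCiDerivAt _ (linExt_mem_Lip hτh hτ.2.le y v)
  rw [← ha, ← hp] at h1
  have hva := fun {ξ : ℝ} => val_linExt_of_le (τ := ξ) hτh y v
  set z := linExt τ hτh y v with hz
  have hcont : Continuous fun r => H (projIcc 0 T hT r) z s :=
    (hHc.continuous_comp_projIcc hT s).comp (f := fun r : ℝ => (z, r)) (by fun_prop)
  have h2 := (hasDerivAt_iff_isLittleO.1
    (hcont.integral_hasStrictDerivAt τ τ).hasDerivAt).mono (nhdsWithin_le_nhds (s := Ioi τ))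
  refine (h1.add h2).congr' ?_ EventuallyEq.rfl
  filter_upwards [Ioc_mem_nhdsGT hτ.2] with ξ hξ
  have hξm : ξ ∈ Icc 0 T := ⟨by linarith [hτ.1, hξ.1], hξ.2⟩
  have h3 := hHJ τ hτ y
  rw [← ha, ← hp] at h3
  have h4 : H τ y s = H τ z s := hH s τ hτ y z hag
  rw [integral_projIcc H hT s z hτm hξm, intervalIntegral.integral_same, defect,
    projIcc_of_mem hT hτm, ← h4, hva hξ.1.le hξ.2, add_sub_cancel_left,
    inner_smul_right, inner_smul_right, smul_eq_mul]
  rw [inner_sub_left] at hpv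
  linear_combination (-(ξ - τ)) * h3 - (ξ - τ) * hpv

/-! ### From infinitesimal steps to a characteristic -/

theorem exists_abs_defect_le {c : ℝ} (hc : 0 < c) (hh : 0 ≤ h)
    {H : ℝ → Paths h T n → E n → ℝ} (hH : ∀ s, NonAnticipative fun t x => H t x s)
    (hHc : ContinuousHamiltonian H) (hHl : HamiltonianLipschitz c H) {φ : ℝ → Paths h T n → ℝ}
    (hφ : ContinuousFunctional φ)
    (hd : ∀ t ∈ Ico 0 T, ∀ x, CiDifferentiableAt φ t x) (hHJ : SatisfiesHJ H φ)
    (s : E n) {t : ℝ} (ht : t ∈ Ico 0 T) (x : Paths h T n) {ε : ℝ} (hε : 0 < ε) :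
    ∃ y ∈ SpeedBounded c t x, ∀ ξ ∈ Icc t T, |defect H φ s t x y ξ| ≤ ε * (ξ - t) := by
  have hφn := nonAnticipative_of_ciDifferentiableAt hh hφ hd
  have hth : t ∈ Icc (-h) T := ⟨by linarith [ht.1], ht.2.le⟩
  have hZ := isCompact_speedBounded hc hth x
  set Z := SpeedBounded c t x
  -- Pairs of a time and a path that is good up to this time. The truncation `min ξ p.1` lets `ξ`
  -- range over a fixed interval, so `A` is an intersection of closed sets; its time projection is
  -- compact, which settles limit times in the real induction.
  let A : Set (ℝ × Paths h T n) := {p | p ∈ Icc t T ×ˢ Z ∧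
    ∀ ξ ∈ Icc t T, |defect H φ s t x p.2 (min ξ p.1)| ≤ ε * (min ξ p.1 - t)}
  have hA : IsCompact A := by
    refine (isCompact_Icc.prod hZ).of_isClosed_subset ?_ fun p hp => hp.1
    have hA' : A = (Icc t T ×ˢ Z) ∩ ⋂ ξ ∈ Icc t T, {p | p ∈ Icc t T ×ˢ Z ∧
        |defect H φ s t x p.2 (min ξ p.1)| ≤ ε * (min ξ p.1 - t)} := by
      ext p
      simp only [A, mem_ofPred_eq, mem_inter_iff, mem_iInter]
      exact ⟨fun hp => ⟨hp.1, fun ξ hξ => ⟨hp.1, hp.2 ξ hξ⟩⟩,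
        fun hp => ⟨hp.1, fun ξ hξ => (hp.2 ξ hξ).2⟩⟩
    rw [hA']
    have hcl : IsClosed (Icc t T ×ˢ Z) := isClosed_Icc.prod hZ.isClosed
    refine hcl.inter (isClosed_biInter fun ξ hξ => ?_)
    refine hcl.isClosed_le ?_ (by fun_prop)
    refine ContinuousOn.abs ?_
    exact (continuousOn_defect hHc hφ hh s (Ico_subset_Icc_self ht) x hZ).comp
      (f := fun p : ℝ × Paths h T n => (min ξ p.1, p.2)) (by fun_prop)
      fun p hp => ⟨⟨le_min hξ.1 hp.1.1, (min_le_right _ _).trans hp.1.2⟩, hp.2⟩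
  have hS : ∀ τ ∈ Icc t T, τ ∈ Prod.fst '' A ↔
      ∃ y ∈ Z, ∀ ξ ∈ Icc t τ, |defect H φ s t x y ξ| ≤ ε * (ξ - t) := by
    intro τ hτ
    constructor
    · rintro ⟨⟨τ, y⟩, hp, rfl⟩
      refine ⟨y, hp.1.2, fun ξ hξ => ?_⟩
      have := hp.2 ξ ⟨hξ.1, hξ.2.trans hτ.2⟩
      simpa [min_eq_left hξ.2] using this
    · rintro ⟨y, hy, hb⟩
      exact ⟨(τ, y), ⟨⟨hτ, hy⟩, fun ξ hξ => hb _ ⟨le_min hξ.1 hτ.1, min_le_right _ _⟩⟩, rfl⟩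
  have hm := maxNorm_nonneg x hth
  have hsub : Icc t T ⊆ Prod.fst '' A := by
    refine IsClosed.Icc_subset_of_forall_exists_gt
      ((hA.image continuous_fst).isClosed.inter isClosed_Icc) ?_ ?_
    · refine (hS t ⟨le_rfl, ht.2.le⟩).2 ⟨linExt t hth.1 x 0, ?_, ?_⟩
      · refine linExt_mem_speedBounded hc hth.1 le_rfl ht.2.le (fun _ _ => rfl) ?_
          (by rw [norm_zero]; positivity)
        intro a b ha hab hb
        rw [le_antisymm (hab.trans hb) ha, le_antisymm hb (ha.trans hab)]
        simp
      · intro ξ hξ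
        rw [le_antisymm hξ.2 hξ.1, ← defect_congr (hH s) hφn hh ht.1 le_rfl ht.2 x
          (agreeUpTo_linExt hth.1 ht.2.le x 0)]
        simp [defect]
    · rintro τ ⟨hτA, hτ⟩ τ₁ hτ₁
      obtain ⟨y, hy, hyb⟩ := (hS τ (Ico_subset_Icc_self hτ)).1 hτA
      have hτ0 : τ ∈ Ico 0 T := ⟨ht.1.trans hτ.1, hτ.2⟩
      obtain ⟨v, hv, ho⟩ := exists_linExt_defect_isLittleO hc hH hHc hHl hd hHJ s hτ0
        (hth.1.trans hτ.1) y
      have hag := agreeUpTo_linExt (hth.1.trans hτ.1) hτ.2.le y v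
      have hz : linExt τ (hth.1.trans hτ.1) y v ∈ Z :=
        linExt_mem_speedBounded hc hth.1 hτ.1 hτ.2.le hy.1
          (fun a b ha hab hb => hy.2 a b ha hab (hb.trans hτ.2.le)) hv
      set z := linExt τ (hth.1.trans hτ.1) y v
      -- Up to `u` the new piece contributes at most `ε (ξ - τ)`, which adds to `ε (τ - t)` to give
      -- `ε (ξ - t)`.
      obtain ⟨u, hu, hub⟩ := mem_nhdsGT_iff_exists_Ioc_subset.1 (ho.def hε)
      have hmem : min (min u τ₁) T ∈ Ioc τ τ₁ :=
        ⟨lt_min (lt_min hu hτ₁) hτ.2, (min_le_left _ _).trans (min_le_right _ _)⟩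
      have hmT : min (min u τ₁) T ≤ T := min_le_right _ _
      have hmu : min (min u τ₁) T ≤ u := (min_le_left _ _).trans (min_le_left _ _)
      refine ⟨min (min u τ₁) T, (hS _ ⟨hτ.1.trans hmem.1.le, hmT⟩).2 ⟨z, hz, ?_⟩, hmem⟩
      intro ξ hξ
      rcases le_or_gt ξ τ with h1 | h1
      · rw [← defect_congr (hH s) hφn hh ht.1 hξ.1 (h1.trans_lt hτ.2) x (hag.mono h1)]
        exact hyb ξ ⟨hξ.1, h1⟩
      · rw [defect_add (hH s) hHc φ ht.1 hτ.1 h1.le hτ.2 (hξ.2.trans hmT) x hag]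
        have h2 := hyb τ ⟨hτ.1, le_rfl⟩
        have h3 : ‖defect H φ s τ y z ξ‖ ≤ ε * ‖ξ - τ‖ := hub ⟨h1, hξ.2.trans hmu⟩
        rw [Real.norm_eq_abs, Real.norm_eq_abs, abs_of_pos (sub_pos.2 h1)] at h3
        refine (abs_add_le _ _).trans ?_
        linarith
  exact (hS T ⟨ht.2.le, le_rfl⟩).1 (hsub ⟨ht.2.le, le_rfl⟩)

/-- Cantor's intersection theorem: the paths with error rate at most `1 / (k + 1)` form a decreasing
sequence of nonempty compact sets. -/
theorem exists_defect_eq_zero {c : ℝ} (hc : 0 < c) (hh : 0 ≤ h)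
    {H : ℝ → Paths h T n → E n → ℝ} (hH : ∀ s, NonAnticipative fun t x => H t x s)
    (hHc : ContinuousHamiltonian H) (hHl : HamiltonianLipschitz c H) {φ : ℝ → Paths h T n → ℝ}
    (hφ : ContinuousFunctional φ)
    (hd : ∀ t ∈ Ico 0 T, ∀ x, CiDifferentiableAt φ t x) (hHJ : SatisfiesHJ H φ)
    (s : E n) {t : ℝ} (ht : t ∈ Ico 0 T) (x : Paths h T n) :
    ∃ y ∈ SpeedBounded c t x, ∀ ξ ∈ Icc t T, defect H φ s t x y ξ = 0 := by
  have hth : t ∈ Icc (-h) T := ⟨by linarith [ht.1], ht.2.le⟩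
  have hZ := isCompact_speedBounded hc hth x
  set Z := SpeedBounded c t x
  let B : ℕ → Set (Paths h T n) := fun k => {y | y ∈ Z ∧
    ∀ ξ ∈ Icc t T, |defect H φ s t x y ξ| ≤ 1 / ((k : ℝ) + 1) * (ξ - t)}
  have hBc : ∀ k, IsClosed (B k) := by
    intro k
    have hB' : B k = Z ∩ ⋂ ξ ∈ Icc t T, {y | y ∈ Z ∧
        |defect H φ s t x y ξ| ≤ 1 / ((k : ℝ) + 1) * (ξ - t)} := by
      ext p
      simp only [B, mem_ofPred_eq, mem_inter_iff, mem_iInter]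
      exact ⟨fun hp => ⟨hp.1, fun ξ hξ => ⟨hp.1, hp.2 ξ hξ⟩⟩,
        fun hp => ⟨hp.1, fun ξ hξ => (hp.2 ξ hξ).2⟩⟩
    rw [hB']
    refine hZ.isClosed.inter (isClosed_biInter fun ξ hξ => ?_)
    refine hZ.isClosed.isClosed_le (ContinuousOn.abs ?_) continuousOn_const
    exact (continuousOn_defect hHc hφ hh s (Ico_subset_Icc_self ht) x hZ).comp
      (f := fun y : Paths h T n => (ξ, y)) (by fun_prop) fun y hy => ⟨hξ, hy⟩
  obtain ⟨y, hy⟩ := IsCompact.nonempty_iInter_of_sequence_nonempty_isCompact_isClosed B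
    (fun k y hy => ⟨hy.1, fun ξ hξ => (hy.2 ξ hξ).trans (mul_le_mul_of_nonneg_right
      (one_div_le_one_div_of_le (by positivity) (by push_cast; linarith)) (sub_nonneg.2 hξ.1))⟩)
    (fun k => exists_abs_defect_le hc hh hH hHc hHl hφ hd hHJ s ht x (by positivity))
    (hZ.of_isClosed_subset (hBc 0) fun y hy => hy.1) hBc
  rw [mem_iInter] at hy
  refine ⟨y, (hy 0).1, fun ξ hξ => ?_⟩
  have hlim := tendsto_one_div_add_atTop_nhds_zero_nat.mul_const (b := ξ - t)
  rw [zero_mul] at hlim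
  exact abs_nonpos_iff.1 (ge_of_tendsto' hlim fun k => (hy k).2 ξ hξ)

end PathHJ

theorem mainTheorem5 (n : ℕ) (h T c : ℝ) (hh : 0 < h) (hT : 0 < T) (hc : 0 < c)
    (H : ℝ → PathHJ.Paths h T n → PathHJ.E n → ℝ) (σ : PathHJ.Paths h T n → ℝ)
    (hH_nonAnticipative : ∀ s : PathHJ.E n, PathHJ.NonAnticipative fun t x => H t x s)
    (hH_continuous : PathHJ.ContinuousHamiltonian H) (hσ_continuous : Continuous σ)
    (hH_lipschitz : PathHJ.HamiltonianLipschitz c H)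
    (φ : ℝ → PathHJ.Paths h T n → ℝ) (hφ_continuous : PathHJ.ContinuousFunctional φ)
    (hφ_diff : ∀ t ∈ Set.Ico 0 T, ∀ x : PathHJ.Paths h T n, PathHJ.CiDifferentiableAt φ t x)
    (hφ_HJ : PathHJ.SatisfiesHJ H φ) (hφ_boundary : PathHJ.SatisfiesBoundary σ φ) :
    PathHJ.IsMinimaxSolution c H σ φ := by
  have hφ_nonAnticipative :=
    PathHJ.nonAnticipative_of_ciDifferentiableAt hh.le hφ_continuous hφ_diff
  refine ⟨hφ_nonAnticipative, hφ_continuous, hφ_boundary, fun t ht x s => ?_⟩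
  obtain ⟨y, hy, hy0⟩ := PathHJ.exists_defect_eq_zero hc hh.le hH_nonAnticipative hH_continuous
    hH_lipschitz hφ_continuous hφ_diff hφ_HJ s ht x
  refine ⟨y, PathHJ.speedBounded_subset_Y hc ⟨by linarith [ht.1], ht.2.le⟩ x hy, fun τ hτ => ?_⟩
  have := hy0 τ hτ
  rw [PathHJ.defect] at this
  linarith
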